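/- Let $G=(V,E)$ be a finite, undirected, connected graph with $n=|V|$ vertices, called resources. There are $m$ users; a state is a map $a:[m]\to V$ assigning users to resources, and $x_v=|\{i: a_i=v\}|$ is the load of $v$. The thresholds are user-independent: every resource $v$ has one real threshold $T_v$, which applies to all users. They are feasible: there is a state in which $x_v\le T_v$ for every resource $v$ that holds at least one user. For a state with loads $x$ let $\Phi_v(x)=x_v-k_v$, where $k_v$ is the largest $k\in\{1,\dots,x_v\}$ with $k\le T_v$, and $k_v=0$ if there is none (so $\Phi_v(x)=\max\{x_v-T_v,0\}$ if $T_v$ is a non-negative integer), and let $\Phi(x)=\sum_{v\in V}\Phi_v(x)$ be the potential. In each round of the user-controlled protocol with parameter $\alpha$, all users act simultaneously and independently: a user on $v$ decides to migrate with probability $\alpha\,\Phi_v(x)/x_v$, and a migrating user moves to a neighbor of $v$ chosen uniformly at random. Let $\mathsf{H}(G)=\max_{u,v\in V}\mathsf{H}(u,v)$, where $\mathsf{H}(u,v)$ is the expected time until the simple random walk on $G$ started at $u$ is at $v$ for the first time ($\mathsf{H}(u,u)=0$). Let $\alpha=1/(2e)$. There is an absolute constant $C$ such that for every such $G$, every $m$,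 all feasible user-independent thresholds and every initial state, the expected number of rounds until the protocol reaches a state with potential $\Phi(x)\le C\cdot n\cdot\mathsf{H}(G)$ is at most $C\cdot\mathsf{H}(G)\cdot\log m$. -/

import Mathlib

open scoped NNReal ENNReal
open MeasureTheory ProbabilityTheory

namespace ThresholdBalancing

noncomputable section

/-! ### Finite Markov chains and hitting times -/

/-- The conditional law of the state at time `n + 1`, given the states up to time `n`, for the
time-homogeneous Markov chain with transition probabilities `K s s'` (from `s` to `s'`). -/
def stepKernel {S : Type*} [MeasurableSpace S] [DiscreteMeasurableSpace S] [Countable S]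
    (K : S → PMF S) (n : ℕ) : Kernel (Finset.Iic n → S) S :=
  Kernel.ofFunOfCountable fun h => (K (h ⟨n, Finset.mem_Iic.2 le_rfl⟩)).toMeasure

instance {S : Type*} [MeasurableSpace S] [DiscreteMeasurableSpace S] [Countable S]
    (K : S → PMF S) (n : ℕ) : IsMarkovKernel (stepKernel K n) :=
  ⟨fun h => PMF.toMeasure.isProbabilityMeasure (K (h ⟨n, Finset.mem_Iic.2 le_rfl⟩))⟩

/-- The law, on the space of trajectories `ℕ → S`, of the Markov chain with transition
probabilities `K` that starts in `s₀` (Ionescu-Tulcea construction). -/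
def chainLaw {S : Type*} [MeasurableSpace S] [DiscreteMeasurableSpace S] [Countable S]
    (K : S → PMF S) (s₀ : S) : Measure (ℕ → S) :=
  Kernel.traj (X := fun _ : ℕ => S) (stepKernel K) 0 (fun _ => s₀)

/-- The expected number of steps until the chain with transition probabilities `K`, started in
`s₀`, is in the set `A` for the first time (time `0` counts; the value is `∞` on trajectories
that never visit `A`). -/
def expectedHittingTime {S : Type*} [Countable S] (K : S → PMF S) (s₀ : S) (A : Set S) : ℝ≥0∞ :=
  letI : MeasurableSpace S := ⊤
  ∫⁻ ω, ENat.toENNReal (hittingAfter (fun (t : ℕ) (ω : ℕ → S) => ω t) A 0 ω) ∂(chainLaw K s₀)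

/-! ### Random walk on the graph -/

section Graph

variable {V : Type*} [Fintype V] [DecidableEq V] (G : SimpleGraph V) [DecidableRel G.Adj]

/-- One step of the random walk: move to a uniformly random neighbour. (A vertex without
neighbours is never left; in a connected graph this only concerns the one-vertex graph.) -/
def walkStep (v : V) : PMF V :=
  if h : (G.neighborFinset v).Nonempty then PMF.uniformOfFinset (G.neighborFinset v) h
  else PMF.pure v

/-- The maximum hitting time `H(G) = max_{u,v} H(u,v)` of the random walk. -/
def maxHittingTime : ℝ≥0∞ :=
  ⨆ (u : V) (v : V), expectedHittingTime (walkStep G) u {v}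

/-- With probability `p` move to a uniformly random neighbour, otherwise stay. -/
def lazyStep (p : ℝ≥0) (hp : p ≤ 1) (v : V) : PMF V :=
  PMF.ofFintype (fun w => (p : ℝ≥0∞) * walkStep G v w + (1 - (p : ℝ≥0∞)) * PMF.pure v w) (by
    have h1 : ∑ w, walkStep G v w = 1 := by
      rw [← tsum_fintype (L := .unconditional _)]
      exact (walkStep G v).tsum_coe
    have h2 : ∑ w, PMF.pure v w = 1 := by
      rw [← tsum_fintype (L := .unconditional _)]
      exact (PMF.pure v).tsum_coe
    rw [Finset.sum_add_distrib, ← Finset.mul_sum, ← Finset.mul_sum, h1, h2, mul_one, mul_one]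
    exact add_tsub_cancel_of_le (by exact_mod_cast hp))

end Graph

/-- The joint law of independent random variables with laws `q i`, `i ∈ ι`. -/
def independentPMF {ι V : Type*} [Fintype ι] [DecidableEq ι] [Fintype V] (q : ι → PMF V) :
    PMF (ι → V) :=
  PMF.ofFintype (fun b => ∏ i, q i (b i)) (by
    have h (i : ι) : ∑ w, q i w = 1 := by
      rw [← tsum_fintype (L := .unconditional _)]
      exact (q i).tsum_coe
    rw [← Fintype.prod_sum]
    simp [h])

/-! ### Threshold load balancing

`m` users are assigned to the vertices (resources) of a graph; a state is a map `a : Fin m → V`,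
and `T i v` is the threshold of user `i` for resource `v`. -/

section Model

variable {V : Type*} [DecidableEq V] {m : ℕ}

/-- The load `x_v` of resource `v` in state `a`. -/
def load (a : Fin m → V) (v : V) : ℕ :=
  (Finset.univ.filter fun i => a i = v).card

/-- In a balanced state every user is happy with the load of its resource. -/
def IsBalanced (T : Fin m → V → ℝ) (a : Fin m → V) : Prop :=
  ∀ i, (load a (a i) : ℝ) ≤ T i (a i)

/-- Thresholds are feasible if they allow a balanced state. -/
def Feasible (T : Fin m → V → ℝ) : Prop :=
  ∃ a : Fin m → V, IsBalanced T a

/-- Thresholds are user-independent if they depend on the resource only. -/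
def UserIndependent (T : Fin m → V → ℝ) : Prop :=
  ∃ t : V → ℝ, ∀ i v, T i v = t v

open scoped Classical in
/-- The number `k` of the last position, in the ranking of the users on `v` by non-increasing
threshold, whose user `i` satisfies `k ≤ T i v` (and `0` if there is none). The user in position
`k` has threshold at least `k` iff at least `k` users on `v` have threshold at least `k`. -/
def lastPosition (T : Fin m → V → ℝ) (a : Fin m → V) (v : V) : ℕ :=
  Nat.findGreatest
    (fun k => k ≤ (Finset.univ.filter fun i => a i = v ∧ (k : ℝ) ≤ T i v).card) (load a v)

/-- The contribution `Φ_v = x_v - k` of resource `v` to the potential. -/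
def potentialAt (T : Fin m → V → ℝ) (a : Fin m → V) (v : V) : ℕ :=
  load a v - lastPosition T a v

/-- The potential `Φ = ∑_v Φ_v`. -/
def potential [Fintype V] (T : Fin m → V → ℝ) (a : Fin m → V) : ℕ :=
  ∑ v, potentialAt T a v

/-- The probability `α · Φ_v / x_v` with which each user on `v` decides to migrate. -/
def migrationProb (α : ℝ≥0) (T : Fin m → V → ℝ) (a : Fin m → V) (v : V) : ℝ≥0 :=
  α * ((potentialAt T a v : ℝ≥0) / (load a v : ℝ≥0))

theorem migrationProb_le_one {α : ℝ≥0} (hα : α ≤ 1) (T : Fin m → V → ℝ) (a : Fin m → V) (v : V) :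
    migrationProb α T a v ≤ 1 :=
  mul_le_one' hα (div_le_one_of_le₀ (by exact_mod_cast Nat.sub_le _ _) (zero_le))

/-- One round of the user-controlled protocol: all users act simultaneously and independently;
a user on `v` migrates with probability `α · Φ_v / x_v`, and then moves to a uniformly random
neighbour of `v`. -/
def userRound [Fintype V] (G : SimpleGraph V) [DecidableRel G.Adj] (α : ℝ≥0) (hα : α ≤ 1)
    (T : Fin m → V → ℝ) (a : Fin m → V) : PMF (Fin m → V) :=
  independentPMF fun i =>
    lazyStep G (migrationProb α T a (a i)) (migrationProb_le_one hα T a (a i)) (a i)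

end Model

/-- The value `α = 1 / (2e)`. -/
def alpha : ℝ≥0 := ⟨1 / (2 * Real.exp 1), by positivity⟩

theorem alpha_le_one : alpha ≤ 1 := by
  have h : (1 : ℝ) ≤ 2 * Real.exp 1 := by linarith [Real.add_one_le_exp 1]
  exact NNReal.coe_le_coe.1 (div_le_one_of_le₀ h (by positivity))

end

end ThresholdBalancing

namespace ThresholdBalancing

noncomputable section

/-! ### First-step analysis of hitting times -/

section Chain

variable {S : Type*} [Fintype S]

/-! The raw potential `Φ` need not decrease in one round, so the proof follows a different quantity.
Put `c_v = ⌊T_v⌋₊`, so that `Φ_v` is the positive part of `x_v - c_v`, and let `U` be the least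
expected number of single-unit random-walk moves with which a player can remove all overloads
(`stabilizationCost`). Moves commute, so a move from an overloaded vertex is always optimal and
lowers `U` by at least 1 in expectation (`one_add_sum_stabilizationCost_le`). Any other move raises
`U` by at most `H` in expectation, since the unit can be walked back
(`sum_stabilizationCost_moveUnit_le`). Feasibility leaves room for every excess unit, whence `U ≤
H·Φ` (`stabilizationCost_le`).

A round is a sequence of such moves. The first `Φ_v` departures from `v` are good and only the
surplus is bad. About `αΦ` users leave in expectation, while `(1 + p)^{x_v} ≤ e^{αΦ_v} ≤ 2^{Φ_v}`
bounds the expected surplus by 1 per vertex. Hence `E[U'] + αΦ ≤ U + (H + 1)n`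
(`sum_userRound_stabilizationCost_add_le`). Once `Φ > 36nH`, the drift `αΦ` dominates the error, and
`U` shrinks in expectation by a factor `1 - 1/(12H)`. Multiplicative drift
(`expectedHittingTime_le_of_multiplicativeDrift`) then gives `O(H log U) = O(H log m)` rounds. -/

theorem sum_coe_eq_one (p : PMF S) : ∑ s, p s = 1 := by
  rw [← tsum_fintype (L := .unconditional _)]
  exact p.tsum_coe

/-- The law of the trajectories that extend the given history `x` up to time `n`. -/
abbrev chainLawFrom [MeasurableSpace S] [DiscreteMeasurableSpace S]
    (K : S → PMF S) (n : ℕ) (x : Finset.Iic n → S) : Measure (ℕ → S) :=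
  Kernel.traj (X := fun _ : ℕ => S) (stepKernel K) n x

theorem lintegral_chainLawFrom [MeasurableSpace S] [DiscreteMeasurableSpace S]
    (K : S → PMF S) (n : ℕ) (x : Finset.Iic n → S)
    (F : (Finset.Iic n → S) → S → ℝ≥0∞) :
    ∫⁻ ω, F (fun i => ω i) (ω (n + 1)) ∂(chainLawFrom K n x) =
      ∑ s, K (x ⟨n, Finset.mem_Iic.2 le_rfl⟩) s * F x s := by
  have hF : Measurable (Function.uncurry F) := measurable_of_countable _
  have hFm : Measurable fun ω : ℕ → S => F (fun i => ω i) (ω (n + 1)) :=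
    hF.comp (f := fun ω : ℕ → S => ((fun i => ω i : Finset.Iic n → S), ω (n + 1)))
      (by fun_prop)
  refine (Kernel.lintegral_traj (X := fun _ : ℕ => S) (κ := stepKernel K) x hFm).trans ?_
  have h1 (ω : ℕ → S) :
      (fun i : Finset.Iic n => Function.updateFinset ω (Finset.Iic n) x i) = x := by
    ext i
    simp [Function.updateFinset]
  have h2 (ω : ℕ → S) : Function.updateFinset ω (Finset.Iic n) x (n + 1) = ω (n + 1) := by
    simp [Function.updateFinset]
  simp only [h1, h2]
  have hf : Measurable (F x) := measurable_of_countable _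
  have h3 : ∫⁻ s, F x s ∂((Kernel.traj (X := fun _ : ℕ => S) (stepKernel K) n).map
      (fun ω => ω (n + 1)) x) = ∫⁻ s, F x s ∂(stepKernel K n x) := by
    rw [Kernel.map_traj_succ_self]
  rw [Kernel.map_apply _ (by fun_prop), lintegral_map hf (by fun_prop)] at h3
  refine h3.trans ?_
  change ∫⁻ s, F x s ∂((K (x ⟨n, Finset.mem_Iic.2 le_rfl⟩)).toMeasure) = _
  rw [lintegral_fintype]
  refine Finset.sum_congr rfl fun s _ => ?_
  rw [PMF.toMeasure_apply_singleton _ _ (MeasurableSet.singleton s), mul_comm]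

theorem lintegral_chainLaw_eq_lintegral [MeasurableSpace S] [DiscreteMeasurableSpace S]
    (K : S → PMF S) (s₀ : S) (n : ℕ) {F : (ℕ → S) → ℝ≥0∞} (hF : Measurable F) :
    ∫⁻ ω, F ω ∂(chainLaw K s₀) =
      ∫⁻ x, (∫⁻ ω, F ω ∂(chainLawFrom K n x))
        ∂(Kernel.partialTraj (X := fun _ : ℕ => S) (stepKernel K) 0 n (fun _ => s₀)) := by
  have h := Kernel.traj_comp_partialTraj (X := fun _ : ℕ => S) (κ := stepKernel K) (Nat.zero_le n)
  unfold chainLaw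
  refine Eq.trans ?_ (Kernel.lintegral_comp _ _ _ hF)
  exact congrArg (fun κ : Kernel (Finset.Iic 0 → S) (ℕ → S) => ∫⁻ ω, F ω ∂(κ (fun _ => s₀))) h.symm

/-- The Markov property: conditionally on the history up to time `n`, the factor `g` is constant and
the next state has law `K (ω n)`. -/
theorem lintegral_chainLaw_mul_succ [MeasurableSpace S] [DiscreteMeasurableSpace S]
    (K : S → PMF S) (s₀ : S) (n : ℕ) (g : (Finset.Iic n → S) → ℝ≥0∞) (f : S → ℝ≥0∞) :
    ∫⁻ ω, g (fun i => ω i) * f (ω (n + 1)) ∂(chainLaw K s₀) =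
      ∫⁻ ω, g (fun i => ω i) * ∑ s, K (ω n) s * f s ∂(chainLaw K s₀) := by
  have hg : Measurable g := measurable_of_countable g
  have hf : Measurable f := measurable_of_countable f
  have hk : Measurable fun s => ∑ s', K s s' * f s' := measurable_of_countable _
  have hg' : Measurable fun ω : ℕ → S => g (fun i => ω i) := hg.comp (by fun_prop)
  have hrhs : Measurable fun ω : ℕ → S => g (fun i => ω i) * ∑ s, K (ω n) s * f s :=
    hg'.mul (hk.comp (measurable_pi_apply n))
  rw [lintegral_chainLaw_eq_lintegral K s₀ n (by fun_prop),
    lintegral_chainLaw_eq_lintegral K s₀ n hrhs]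
  refine lintegral_congr fun x => ?_
  rw [lintegral_chainLawFrom K n x fun y s => g y * f s,
    lintegral_chainLawFrom K n x
      fun y _ => g y * ∑ s, K (y ⟨n, Finset.mem_Iic.2 le_rfl⟩) s * f s,
    ← Finset.sum_mul, sum_coe_eq_one, one_mul, Finset.mul_sum]
  exact Finset.sum_congr rfl fun s _ => by ring

theorem lintegral_chainLaw_zero [MeasurableSpace S] [DiscreteMeasurableSpace S]
    (K : S → PMF S) (s₀ : S) (f : S → ℝ≥0∞) :
    ∫⁻ ω, f (ω 0) ∂(chainLaw K s₀) = f s₀ := by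
  have h := lintegral_chainLawFrom K 0 (fun _ => s₀) fun y _ => f (y ⟨0, by simp⟩)
  rw [← Finset.sum_mul, sum_coe_eq_one, one_mul] at h
  exact h

open scoped Classical in
/-- The expectation of `f` at time `n` on the event that the chain started in `s` has avoided `A`
at the times `0, …, n`. -/
def avoidingExpectation (K : S → PMF S) (A : Set S) (f : S → ℝ≥0∞) : ℕ → S → ℝ≥0∞
  | 0, s => if s ∈ A then 0 else f s
  | n + 1, s => if s ∈ A then 0 else ∑ s', K s s' * avoidingExpectation K A f n s'

open scoped Classical in
-- The recursion peels off the first step, whereas the trajectory measure conditions on the last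
-- one; this converts between the two.
theorem avoidingExpectation_succ' (K : S → PMF S) (A : Set S) (f : S → ℝ≥0∞) (n : ℕ) (s : S) :
    avoidingExpectation K A f (n + 1) s =
      avoidingExpectation K A (fun s => ∑ s', K s s' * if s' ∈ A then 0 else f s') n s := by
  induction n generalizing s with
  | zero => rfl
  | succ n ih =>
    rw [avoidingExpectation]
    simp only [ih]
    rfl

open scoped Classical in
theorem lintegral_chainLaw_avoiding [MeasurableSpace S] [DiscreteMeasurableSpace S]
    (K : S → PMF S) (s₀ : S) (A : Set S) (f : S → ℝ≥0∞) (n : ℕ) :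
    ∫⁻ ω, (if ∃ j ≤ n, ω j ∈ A then 0 else f (ω n)) ∂(chainLaw K s₀) =
      avoidingExpectation K A f n s₀ := by
  induction n generalizing f with
  | zero =>
    rw [avoidingExpectation, ← lintegral_chainLaw_zero K s₀ (fun s => if s ∈ A then 0 else f s)]
    simp
  | succ n ih =>
    rw [avoidingExpectation_succ', ← ih]
    have h := lintegral_chainLaw_mul_succ K s₀ n
      (fun x : Finset.Iic n → S => if ∃ j, x j ∈ A then 0 else 1) (fun s => if s ∈ A then 0 else f s)
    have hex (ω : ℕ → S) : (∃ j : Finset.Iic n, ω j ∈ A) ↔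
        ∃ j ≤ n, ω j ∈ A := by
      simp
    simp only [hex, ite_mul, zero_mul, one_mul] at h
    rw [← h]
    refine lintegral_congr fun ω => ?_
    have hsucc : (∃ j ≤ n + 1, ω j ∈ A) ↔ (∃ j ≤ n, ω j ∈ A) ∨ ω (n + 1) ∈ A := by
      constructor
      · rintro ⟨j, hj, hA⟩
        rcases Nat.le_succ_iff.1 hj with h | rfl
        · exact Or.inl ⟨j, h, hA⟩
        · exact Or.inr hA
      · rintro (⟨j, hj, hA⟩ | hA)
        · exact ⟨j, hj.trans n.le_succ, hA⟩
        · exact ⟨n + 1, le_rfl, hA⟩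
    by_cases h1 : ∃ j ≤ n, ω j ∈ A <;> by_cases h2 : ω (n + 1) ∈ A <;>
      simp only [hsucc, h1, h2, or_true, or_false, if_true, if_false]

theorem toENNReal_eq_tsum (k : ℕ∞) :
    ENat.toENNReal k = ∑' n : ℕ, if k ≤ n then 0 else (1 : ℝ≥0∞) := by
  induction k using ENat.recTopCoe with
  | top => simp
  | coe k =>
    rw [tsum_eq_sum (s := Finset.range k)]
    · rw [Finset.sum_congr rfl (g := fun _ => (1 : ℝ≥0∞))]
      · simp
      · intro n hn
        have := Finset.mem_range.1 hn
        rw [if_neg]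
        simpa using this
    · intro n hn
      rw [if_pos]
      simpa using hn

/-- The tail-sum formula: an extended natural number counts the times strictly before it. It turns
the trajectory integral into finite recursions. -/
theorem expectedHittingTime_eq_tsum (K : S → PMF S) (s₀ : S) (A : Set S) :
    expectedHittingTime K s₀ A = ∑' n, avoidingExpectation K A (fun _ => 1) n s₀ := by
  classical
  let _ : MeasurableSpace S := ⊤
  unfold expectedHittingTime
  simp only [← lintegral_chainLaw_avoiding]
  rw [← lintegral_tsum]
  · refine lintegral_congr fun ω => ?_
    refine (toENNReal_eq_tsum _).trans ?_
    refine tsum_congr fun n => ?_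
    have h : hittingAfter (fun (t : ℕ) (ω : ℕ → S) => ω t) A 0 ω ≤ (n : ℕ∞) ↔
        ∃ j ≤ n, ω j ∈ A := by
      refine hittingAfter_le_iff.trans ?_
      simp
    by_cases hA : ∃ j ≤ n, ω j ∈ A
    · exact (if_pos (h.2 hA)).trans (if_pos hA).symm
    · exact (if_neg fun hn => hA (h.1 hn)).trans (if_neg hA).symm
  · intro n
    refine Measurable.aemeasurable ?_
    refine Measurable.ite ?_ measurable_const measurable_const
    have : {ω : ℕ → S | ∃ j ≤ n, ω j ∈ A} = ⋃ j, ⋃ (_ : j ≤ n), (fun ω : ℕ → S => ω j) ⁻¹' A := by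
      ext ω
      simp
    rw [this]
    exact MeasurableSet.iUnion fun j => MeasurableSet.iUnion fun _ =>
      measurable_pi_apply j (MeasurableSet.of_discrete)

theorem expectedHittingTime_of_mem (K : S → PMF S) {s : S} {A : Set S} (hs : s ∈ A) :
    expectedHittingTime K s A = 0 := by
  rw [expectedHittingTime_eq_tsum, ENNReal.tsum_eq_zero]
  rintro (_ | n) <;> simp [avoidingExpectation, hs]

theorem expectedHittingTime_of_notMem (K : S → PMF S) {s : S} {A : Set S} (hs : s ∉ A) :
    expectedHittingTime K s A = 1 + ∑ s', K s s' * expectedHittingTime K s' A := by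
  simp only [expectedHittingTime_eq_tsum, ← ENNReal.tsum_mul_left]
  rw [← Summable.tsum_finsetSum fun _ _ => ENNReal.summable,
    tsum_eq_zero_add' ENNReal.summable]
  simp [avoidingExpectation, hs]

/-- Every partial sum of the tail series lies below `g`, by induction on its length, so neither
finiteness nor almost sure hitting has to be known beforehand. -/
theorem expectedHittingTime_le_of_supersolution (K : S → PMF S) (A : Set S) (g : S → ℝ≥0∞)
    (hg : ∀ s ∉ A, 1 + ∑ s', K s s' * g s' ≤ g s) (s : S) :
    expectedHittingTime K s A ≤ g s := by
  rw [expectedHittingTime_eq_tsum]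
  refine ENNReal.tsum_le_of_sum_range_le fun n => ?_
  induction n generalizing s with
  | zero => simp
  | succ n ih =>
    by_cases hs : s ∈ A
    · refine le_of_eq_of_le (Finset.sum_eq_zero fun k _ => ?_) zero_le
      cases k <;> simp [avoidingExpectation, hs]
    · rw [Finset.sum_range_succ']
      simp only [avoidingExpectation, hs, if_false]
      rw [add_comm, Finset.sum_comm]
      refine le_trans ?_ (hg s hs)
      gcongr with s'
      rw [← Finset.mul_sum]
      gcongr
      exact ih s'

end Chain

/-! ### The cost of stabilizing a configuration -/

section Stabilization

variable {V : Type*} [DecidableEq V]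

/-- The configuration obtained from `z` by moving one unit from `v` to `w`. -/
def moveUnit (z : V → ℤ) (v w : V) : V → ℤ :=
  z - Pi.single v 1 + Pi.single w 1

theorem moveUnit_comm (z : V → ℤ) (u u' v v' : V) :
    moveUnit (moveUnit z u u') v v' = moveUnit (moveUnit z v v') u u' := by
  simp only [moveUnit]
  abel

theorem moveUnit_moveUnit (z : V → ℤ) (u v w : V) :
    moveUnit (moveUnit z u v) v w = moveUnit z u w := by
  simp only [moveUnit]
  abel

theorem moveUnit_self (z : V → ℤ) (v : V) : moveUnit z v v = z := by
  simp [moveUnit]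

theorem le_moveUnit_of_ne (z : V → ℤ) {u v : V} (huv : u ≠ v) (w : V) :
    z v ≤ moveUnit z u w v := by
  have h : (0 : ℤ) ≤ (Pi.single w 1 : V → ℤ) v := by
    rw [Pi.single_apply]
    split_ifs <;> simp
  simp only [moveUnit, Pi.add_apply, Pi.sub_apply, Pi.single_eq_of_ne huv.symm]
  lia

variable [Fintype V]

theorem sum_moveUnit (z : V → ℤ) (v w : V) : ∑ x, moveUnit z v w x = ∑ x, z x := by
  simp [moveUnit, Finset.sum_add_distrib, Finset.sum_sub_distrib]

/-- The minimal expected number of moves among the first `k` ones that a player needs in order to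
reach a configuration without positive entries. In each move, the player chooses a vertex, from
which a unit moves to a random vertex according to `P`. -/
def stabilizationCostUpTo (P : V → PMF V) : ℕ → (V → ℤ) → ℝ≥0∞
  | 0, _ => 0
  | k + 1, z =>
    if ∀ v, z v ≤ 0 then 0
    else ⨅ v, (1 + ∑ w, P v w * stabilizationCostUpTo P k (moveUnit z v w))

/-- The minimal expected number of moves needed to reach a configuration without positive
entries. -/
def stabilizationCost (P : V → PMF V) (z : V → ℤ) : ℝ≥0∞ :=
  ⨆ k, stabilizationCostUpTo P k z

variable (P : V → PMF V)

theorem stabilizationCostUpTo_succ_le (k : ℕ) (z : V → ℤ) (v : V) :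
    stabilizationCostUpTo P (k + 1) z ≤
      1 + ∑ w, P v w * stabilizationCostUpTo P k (moveUnit z v w) := by
  rw [stabilizationCostUpTo]
  split_ifs
  · exact zero_le
  · exact iInf_le _ v

theorem stabilizationCostUpTo_le_succ (k : ℕ) (z : V → ℤ) :
    stabilizationCostUpTo P k z ≤ stabilizationCostUpTo P (k + 1) z := by
  induction k generalizing z with
  | zero => exact zero_le
  | succ k ih =>
    rw [stabilizationCostUpTo, stabilizationCostUpTo]
    split_ifs
    · exact le_rfl
    · gcongr
      exact ih _

theorem stabilizationCostUpTo_mono (z : V → ℤ) :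
    Monotone fun k => stabilizationCostUpTo P k z :=
  monotone_nat_of_le_succ fun k => stabilizationCostUpTo_le_succ P k z

/-- Moving a unit from an overloaded vertex is an optimal move: since moves commute, the order in
which the overloaded vertices are used does not matter. -/
theorem one_add_sum_stabilizationCostUpTo_le (k : ℕ) (z : V → ℤ) {v : V} (hv : 0 < z v) :
    1 + ∑ w, P v w * stabilizationCostUpTo P k (moveUnit z v w) ≤
      stabilizationCostUpTo P (k + 1) z := by
  have hz : ¬ ∀ v, z v ≤ 0 := fun h => (h v).not_gt hv
  induction k generalizing z with
  | zero =>
    rw [stabilizationCostUpTo, if_neg hz]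
    simp only [stabilizationCostUpTo, mul_zero, Finset.sum_const_zero]
    exact le_iInf fun _ => le_rfl
  | succ k ih =>
    rw [stabilizationCostUpTo, if_neg hz]
    refine le_iInf fun u => ?_
    obtain rfl | huv := eq_or_ne u v
    · exact le_rfl
    -- Exchange argument: after the first move `v`, the move `u` is one admissible continuation.
    -- Swapping the two leaves `u` first and `v` second, and `v` is still overloaded then because
    -- only `u ≠ v` has lost a unit, so the induction hypothesis applies.
    calc 1 + ∑ w, P v w * stabilizationCostUpTo P (k + 1) (moveUnit z v w)
        ≤ 1 + ∑ w, P v w *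
            (1 + ∑ x, P u x * stabilizationCostUpTo P k (moveUnit (moveUnit z v w) u x)) := by
          gcongr with w
          exact stabilizationCostUpTo_succ_le P k _ u
      _ = 1 + ∑ x, P u x *
            (1 + ∑ w, P v w * stabilizationCostUpTo P k (moveUnit (moveUnit z u x) v w)) := by
          simp only [mul_add, mul_one, Finset.sum_add_distrib, sum_coe_eq_one, Finset.mul_sum]
          rw [Finset.sum_comm]
          congr 2
          refine Finset.sum_congr rfl fun x _ => Finset.sum_congr rfl fun w _ => ?_
          rw [moveUnit_comm]
          ring
      _ ≤ 1 + ∑ x, P u x * stabilizationCostUpTo P (k + 1) (moveUnit z u x) := by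
          gcongr with x
          have hx : 0 < moveUnit z u x v := hv.trans_le (le_moveUnit_of_ne z huv x)
          exact ih _ hx fun h => (h v).not_gt hx

theorem one_add_sum_stabilizationCost_le (z : V → ℤ) {v : V} (hv : 0 < z v) :
    1 + ∑ w, P v w * stabilizationCost P (moveUnit z v w) ≤ stabilizationCost P z := by
  simp only [stabilizationCost, ENNReal.mul_iSup]
  rw [ENNReal.finsetSum_iSup_of_monotone fun w => (stabilizationCostUpTo_mono P _).const_mul' _,
    ENNReal.add_iSup]
  exact iSup_le fun k => (one_add_sum_stabilizationCostUpTo_le P k z hv).trans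
    (le_iSup (fun k => stabilizationCostUpTo P k z) (k + 1))

/-- The player keeps moving the unit at `u` until it reaches `w`. This simulates the walk and costs
its hitting time; the moves so used only reduce the remaining budget, and the cost is monotone in
the budget. -/
theorem stabilizationCostUpTo_le_add_hittingTime (k : ℕ) (z : V → ℤ) (v u w : V) :
    stabilizationCostUpTo P k (moveUnit z v u) ≤
      expectedHittingTime P u {w} + stabilizationCostUpTo P k (moveUnit z v w) := by
  induction k generalizing u with
  | zero => exact zero_le
  | succ k ih =>
    obtain rfl | huw := eq_or_ne u w
    · exact le_add_self
    calc stabilizationCostUpTo P (k + 1) (moveUnit z v u)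
        ≤ 1 + ∑ x, P u x * stabilizationCostUpTo P k (moveUnit z v x) := by
          refine (stabilizationCostUpTo_succ_le P k _ u).trans_eq ?_
          simp only [moveUnit_moveUnit]
      _ ≤ 1 + ∑ x, P u x *
            (expectedHittingTime P x {w} + stabilizationCostUpTo P k (moveUnit z v w)) := by
          gcongr with x
          exact ih x
      _ = expectedHittingTime P u {w} + stabilizationCostUpTo P k (moveUnit z v w) := by
          rw [expectedHittingTime_of_notMem P (by simpa using huw)]
          simp only [mul_add, Finset.sum_add_distrib, ← Finset.sum_mul, sum_coe_eq_one, one_mul,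
            add_assoc]
      _ ≤ _ := by
          gcongr
          exact stabilizationCostUpTo_le_succ P k _

theorem stabilizationCost_le_add_hittingTime (z : V → ℤ) (v u w : V) :
    stabilizationCost P (moveUnit z v u) ≤
      expectedHittingTime P u {w} + stabilizationCost P (moveUnit z v w) :=
  iSup_le fun k => (stabilizationCostUpTo_le_add_hittingTime P k z v u w).trans
    (by gcongr; exact le_iSup (fun k => stabilizationCostUpTo P k (moveUnit z v w)) k)

/-- The price of a move from an arbitrary vertex: wherever the unit lands, walking it back to `v`
restores `z`. -/
theorem sum_stabilizationCost_moveUnit_le {H : ℝ≥0∞}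
    (hH : ∀ u w, expectedHittingTime P u {w} ≤ H) (z : V → ℤ) (v : V) :
    ∑ w, P v w * stabilizationCost P (moveUnit z v w) ≤ H + stabilizationCost P z := by
  calc ∑ w, P v w * stabilizationCost P (moveUnit z v w)
      ≤ ∑ w, P v w * (H + stabilizationCost P z) := by
        gcongr with w
        refine (stabilizationCost_le_add_hittingTime P z v w v).trans ?_
        rw [moveUnit_self]
        gcongr
        exact hH w v
    _ = _ := by rw [← Finset.sum_mul, sum_coe_eq_one, one_mul]

theorem stabilizationCost_of_nonpos {z : V → ℤ} (hz : ∀ v, z v ≤ 0) :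
    stabilizationCost P z = 0 := by
  refine ENNReal.iSup_eq_zero.2 fun k => ?_
  cases k <;> simp [stabilizationCostUpTo, hz]

theorem one_le_stabilizationCost {z : V → ℤ} {v : V} (hv : 0 < z v) :
    1 ≤ stabilizationCost P z :=
  le_self_add.trans (one_add_sum_stabilizationCost_le P z hv)

/-- As long as some vertex is overloaded, the total being nonpositive forces a vertex with free
room; walking one excess unit there costs at most `H` and lowers the total excess by one. -/
theorem stabilizationCost_le {H : ℝ≥0∞} (hH : ∀ u w, expectedHittingTime P u {w} ≤ H)
    (z : V → ℤ) (hz : ∑ v, z v ≤ 0) :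
    stabilizationCost P z ≤ H * (∑ v, (z v).toNat : ℕ) := by
  induction hn : ∑ v, (z v).toNat generalizing z with
  | zero =>
    have h0 : ∀ v, z v ≤ 0 := by simpa using hn
    rw [stabilizationCost_of_nonpos P h0]
    exact zero_le
  | succ n ih =>
    obtain ⟨v, hv⟩ : ∃ v, 0 < z v := by
      by_contra! h
      simp [fun v => Int.toNat_of_nonpos (h v)] at hn
    obtain ⟨w, hw⟩ : ∃ w, z w < 0 := by
      by_contra! h
      exact ((Finset.sum_pos' (fun w _ => h w) ⟨v, Finset.mem_univ v, hv⟩).trans_le hz).false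
    have hvw : v ≠ w := by rintro rfl; lia
    have hmove (x : V) : (moveUnit z v w x).toNat + (if x = v then 1 else 0) = (z x).toNat := by
      simp only [moveUnit, Pi.add_apply, Pi.sub_apply, Pi.single_apply]
      split_ifs <;> subst_vars <;> lia
    have hsum : ∑ x, (moveUnit z v w x).toNat = n := by
      have := Finset.sum_congr (rfl : (Finset.univ : Finset V) = _) fun x _ => hmove x
      rw [Finset.sum_add_distrib, hn] at this
      simpa using this
    calc stabilizationCost P z = stabilizationCost P (moveUnit z v v) := by rw [moveUnit_self]
      _ ≤ expectedHittingTime P v {w} + stabilizationCost P (moveUnit z v w) :=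
        stabilizationCost_le_add_hittingTime P z v v w
      _ ≤ H + H * n := add_le_add (hH v w) (ih _ (by rwa [sum_moveUnit]) hsum)
      _ = H * (n + 1 : ℕ) := by push_cast; ring

end Stabilization

/-! ### Independent choices -/

section Independent

variable {ι V : Type*} [Fintype ι] [DecidableEq ι] [Fintype V]

theorem independentPMF_apply (q : ι → PMF V) (b : ι → V) :
    independentPMF q b = ∏ i, q i (b i) :=
  rfl

/-- Resampling one coordinate of a vector of independent random variables. -/
theorem sum_independentPMF_mul_update (q q' : ι → PMF V) (j : ι) (h : ∀ i ≠ j, q i = q' i)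
    (F : (ι → V) → ℝ≥0∞) :
    ∑ b, independentPMF q b * F b =
      ∑ b, independentPMF q' b * ∑ w, q j w * F (Function.update b j w) := by
  have hswap : ∑ x : (ι → V) × V, independentPMF q x.1 * q' j x.2 * F x.1 =
      ∑ x : (ι → V) × V, independentPMF q' x.1 * (q j x.2 * F (Function.update x.1 j x.2)) := by
    -- The involution exchanging the fresh sample `w` with the old coordinate `b j`.
    refine Finset.sum_nbij' (fun x => (Function.update x.1 j x.2, x.1 j))
      (fun x => (Function.update x.1 j x.2, x.1 j)) (by simp) (by simp) (by simp) (by simp) ?_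
    rintro ⟨b, w⟩ -
    simp only [independentPMF_apply, Function.update_idem, Function.update_eq_self]
    rw [← Finset.mul_prod_erase _ _ (Finset.mem_univ j),
      ← Finset.mul_prod_erase _ (fun i => q' i _) (Finset.mem_univ j), Function.update_self,
      Finset.prod_congr rfl (g := fun i => q' i (Function.update b j w i))]
    · ring
    · intro i hi
      have hij := Finset.ne_of_mem_erase hi
      rw [h i hij, Function.update_of_ne hij]
  rw [Fintype.sum_prod_type, Fintype.sum_prod_type] at hswap
  simp only [← Finset.mul_sum] at hswap
  rw [← hswap]
  refine Finset.sum_congr rfl fun b _ => ?_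
  rw [← Finset.sum_mul, ← Finset.mul_sum, sum_coe_eq_one, mul_one]

/-- The probability that exactly the members of `D` decide to migrate, if they decide
independently with probabilities `p i`. -/
def decisionWeight (p : ι → ℝ≥0∞) (D : Finset ι) : ℝ≥0∞ :=
  (∏ i ∈ D, p i) * ∏ i ∈ Dᶜ, (1 - p i)

theorem sum_decisionWeight {p : ι → ℝ≥0∞} (hp : ∀ i, p i ≤ 1) :
    ∑ D, decisionWeight p D = 1 := by
  unfold decisionWeight
  rw [← Fintype.prod_add]
  exact Finset.prod_eq_one fun i _ => add_tsub_cancel_of_le (hp i)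

theorem sum_decisionWeight_mul_card {p : ι → ℝ≥0∞} (hp : ∀ i, p i ≤ 1) :
    ∑ D, decisionWeight p D * (D.card : ℝ≥0∞) = ∑ i, p i := by
  have hcard (D : Finset ι) : (D.card : ℝ≥0∞) = ∑ i, if i ∈ D then 1 else 0 := by simp
  simp only [hcard, Finset.mul_sum]
  rw [Finset.sum_comm]
  refine Finset.sum_congr rfl fun i _ => ?_
  -- Setting the factor of `i` outside `D` to zero encodes `i ∈ D`, so the sum over `D` factorizes
  -- again.
  have hD (D : Finset ι) : decisionWeight p D * (if i ∈ D then 1 else 0) =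
      (∏ k ∈ D, p k) * ∏ k ∈ Dᶜ, if k = i then 0 else (1 - p k) := by
    by_cases hi : i ∈ D
    · rw [if_pos hi, mul_one, decisionWeight]
      congr 1
      refine Finset.prod_congr rfl fun k hk => ?_
      rw [if_neg]
      rintro rfl
      exact (Finset.mem_compl.1 hk) hi
    · have h0 : ∏ k ∈ Dᶜ, (if k = i then 0 else (1 - p k)) = 0 :=
        Finset.prod_eq_zero (Finset.mem_compl.2 hi) (if_pos rfl)
      rw [if_neg hi, mul_zero, h0, mul_zero]
  simp only [hD]
  rw [← Fintype.prod_add, ← Finset.mul_prod_erase _ _ (Finset.mem_univ i), if_pos rfl, add_zero,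
    Finset.prod_eq_one, mul_one]
  intro k hk
  rw [if_neg (Finset.ne_of_mem_erase hk), add_tsub_cancel_of_le (hp k)]

/-- The exponential moment, with base 2, of the number of migrants in `s`; independence makes it a
product. -/
theorem sum_decisionWeight_mul_two_pow {p : ι → ℝ≥0∞} (hp : ∀ i, p i ≤ 1) (s : ι → Prop)
    [DecidablePred s] :
    ∑ D, decisionWeight p D * 2 ^ (D.filter s).card = ∏ i with s i, (1 + p i) := by
  have hD (D : Finset ι) : decisionWeight p D * 2 ^ (D.filter s).card =
      (∏ i ∈ D, p i * if s i then 2 else 1) * ∏ i ∈ Dᶜ, (1 - p i) := by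
    rw [Finset.prod_mul_distrib, decisionWeight, ← Finset.prod_filter, Finset.prod_const]
    ring
  simp only [hD]
  rw [← Fintype.prod_add, Finset.prod_filter]
  refine Finset.prod_congr rfl fun i _ => ?_
  split_ifs
  · rw [mul_two, add_assoc, add_tsub_cancel_of_le (hp i), add_comm]
  · rw [mul_one, add_tsub_cancel_of_le (hp i)]

end Independent

/-! ### The drift of the stabilization cost in one round -/

section Round

variable {V : Type*} [DecidableEq V] {m : ℕ}

/-- The load of each vertex in excess of its capacity. -/
def imbalance (c : V → ℕ) (a : Fin m → V) (v : V) : ℤ :=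
  (load a v : ℤ) - c v

theorem load_update (a : Fin m → V) (j : Fin m) (w v : V) :
    (load (Function.update a j w) v : ℤ) =
      load a v - (Pi.single (a j) 1 : V → ℤ) v + (Pi.single w 1 : V → ℤ) v := by
  have h (b : Fin m → V) : (load b v : ℤ) =
      (if b j = v then 1 else 0) + ∑ i ∈ Finset.univ.erase j, if b i = v then 1 else 0 := by
    rw [Finset.add_sum_erase _ (fun i => if b i = v then (1 : ℤ) else 0) (Finset.mem_univ j), load]
    simp
  rw [h, h a, Function.update_self, Finset.sum_congr rfl
    (g := fun i => if a i = v then (1 : ℤ) else 0)]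
  · simp only [Pi.single_apply, eq_comm (a := v)]
    ring
  · intro i hi
    rw [Function.update_of_ne (Finset.ne_of_mem_erase hi)]

/-- The number of users on `v` who decide to migrate. -/
def departures (a : Fin m → V) (D : Finset (Fin m)) (v : V) : ℕ :=
  (D.filter fun i => a i = v).card

theorem departures_insert (a : Fin m → V) {D : Finset (Fin m)} {j : Fin m} (hj : j ∉ D) (v : V) :
    departures a (insert j D) v = departures a D v + if v = a j then 1 else 0 := by
  unfold departures
  rw [Finset.filter_insert]
  split_ifs with h1 h2 h2
  · rw [Finset.card_insert_of_notMem (by simp [hj])]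
  · exact absurd h1.symm h2
  · exact absurd h2.symm h1
  · rfl

theorem load_le_load_add_departures {a b : Fin m → V} {D : Finset (Fin m)}
    (h : ∀ i ∉ D, b i = a i) (v : V) : load a v ≤ load b v + departures a D v := by
  unfold load departures
  refine (Finset.card_le_card ?_).trans (Finset.card_union_le _ _)
  intro i hi
  simp only [Finset.mem_filter, Finset.mem_univ, true_and, Finset.mem_union] at hi ⊢
  by_cases hD : i ∈ D
  · exact Or.inr ⟨hD, hi⟩
  · exact Or.inl ((h i hD).trans hi)

theorem natCast_sub_le_two_pow (k l : ℕ) : ((k - l : ℕ) : ℝ≥0∞) ≤ 2 ^ k * (2 ^ l)⁻¹ := by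
  have h : (k - l) * 2 ^ l ≤ 2 ^ k := by
    obtain hkl | hkl := le_total k l
    · simp [Nat.sub_eq_zero_of_le hkl]
    · calc (k - l) * 2 ^ l ≤ 2 ^ (k - l) * 2 ^ l :=
            Nat.mul_le_mul_right _ Nat.lt_two_pow_self.le
        _ = 2 ^ k := by rw [← pow_add, Nat.sub_add_cancel hkl]
  rw [← div_eq_mul_inv, ENNReal.le_div_iff_mul_le (by simp) (by simp)]
  exact_mod_cast h

/-- A Chernoff-type estimate: the truncated surplus is at most `2 ^ (departures - k)`, whose mean
the moment hypothesis bounds by 1. -/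
theorem sum_decisionWeight_mul_departures_sub_le {p : Fin m → ℝ≥0∞} (hp : ∀ i, p i ≤ 1)
    (a : Fin m → V) (v : V) (k : ℕ) (hk : ∏ i with a i = v, (1 + p i) ≤ 2 ^ k) :
    ∑ D, decisionWeight p D * ((departures a D v - k : ℕ) : ℝ≥0∞) ≤ 1 := by
  calc ∑ D, decisionWeight p D * ((departures a D v - k : ℕ) : ℝ≥0∞)
      ≤ ∑ D, decisionWeight p D * (2 ^ departures a D v * (2 ^ k)⁻¹) := by
        gcongr with D
        exact natCast_sub_le_two_pow _ _
    _ = (∏ i with a i = v, (1 + p i)) * (2 ^ k)⁻¹ := by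
        rw [← sum_decisionWeight_mul_two_pow hp, Finset.sum_mul]
        exact Finset.sum_congr rfl fun D _ => (mul_assoc _ _ _).symm
    _ ≤ 2 ^ k * (2 ^ k)⁻¹ := by gcongr
    _ = 1 := ENNReal.mul_inv_cancel (by simp) (by simp)

theorem imbalance_update (c : V → ℕ) (a : Fin m → V) (j : Fin m) (w : V) :
    imbalance c (Function.update a j w) = moveUnit (imbalance c a) (a j) w := by
  ext v
  simp only [imbalance, moveUnit, Pi.add_apply, Pi.sub_apply, load_update]
  ring

variable [Fintype V]

theorem sum_load (a : Fin m → V) : ∑ v, load a v = m := by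
  unfold load
  rw [← Finset.card_eq_sum_card_fiberwise fun i _ => Finset.mem_coe.2 (Finset.mem_univ (a i))]
  simp

/-- The state after all users in `D`, and no others, have moved according to `P`. -/
def migrationOf (P : V → PMF V) (a : Fin m → V) (D : Finset (Fin m)) : PMF (Fin m → V) :=
  independentPMF fun i => if i ∈ D then P (a i) else PMF.pure (a i)

theorem eq_of_migrationOf_ne_zero {P : V → PMF V} {a b : Fin m → V} {D : Finset (Fin m)}
    (h : migrationOf P a D b ≠ 0) {i : Fin m} (hi : i ∉ D) : b i = a i := by
  by_contra hne
  refine h (Finset.prod_eq_zero (Finset.mem_univ i) ?_)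
  simp [hi, hne]

theorem sum_departures (a : Fin m → V) (D : Finset (Fin m)) :
    ∑ v, departures a D v = D.card :=
  (Finset.card_eq_sum_card_fiberwise fun i _ => Finset.mem_coe.2 (Finset.mem_univ (a i))).symm

/-- Lets the migrants move one after another: when `D` has moved, `j ∉ D` is still at `a j`, and its
step is an independent unit move from there. -/
theorem sum_migrationOf_insert (P : V → PMF V) (a : Fin m → V) {D : Finset (Fin m)} {j : Fin m}
    (hj : j ∉ D) (c : V → ℕ) (F : (V → ℤ) → ℝ≥0∞) :
    ∑ b, migrationOf P a (insert j D) b * F (imbalance c b) =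
      ∑ b, migrationOf P a D b * ∑ w, P (a j) w * F (moveUnit (imbalance c b) (a j) w) := by
  unfold migrationOf
  rw [sum_independentPMF_mul_update _ (fun i => if i ∈ D then P (a i) else PMF.pure (a i)) j]
  · refine Finset.sum_congr rfl fun b _ => ?_
    obtain hb | hb := eq_or_ne
      (independentPMF (fun i => if i ∈ D then P (a i) else PMF.pure (a i)) b) 0
    · rw [hb, zero_mul, zero_mul]
    · have hbj : b j = a j := eq_of_migrationOf_ne_zero (P := P) hb hj
      simp only [imbalance_update, hbj, Finset.mem_insert_self, if_true]
  · intro i hi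
    simp [hi]

/-- Induction over the migrants: a departure from `v` is good while fewer than the initial excess
have left `v`, and lowers the expected cost by at least one; each later departure raises it by at
most `H`. -/
theorem sum_migrationOf_stabilizationCost_le (P : V → PMF V) {H : ℝ≥0∞}
    (hH : ∀ u w, expectedHittingTime P u {w} ≤ H) (c : V → ℕ) (a : Fin m → V)
    (D : Finset (Fin m)) :
    ∑ b, migrationOf P a D b * stabilizationCost P (imbalance c b) +
        (∑ v, min (departures a D v) (imbalance c a v).toNat : ℕ) ≤
      stabilizationCost P (imbalance c a) +
        H * (∑ v, (departures a D v - (imbalance c a v).toNat) : ℕ) := by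
  induction D using Finset.induction_on with
  | empty =>
    have h1 : ∑ b, migrationOf P a ∅ b * stabilizationCost P (imbalance c b) =
        stabilizationCost P (imbalance c a) := by
      rw [Finset.sum_eq_single a]
      · simp [migrationOf, independentPMF_apply]
      · intro b _ hb
        by_contra h
        exact hb (funext fun i => eq_of_migrationOf_ne_zero (left_ne_zero_of_mul h) (by simp))
      · simp
    simp [h1, departures]
  | insert j D hj ih =>
    rw [sum_migrationOf_insert P a hj]
    set Φ : V → ℕ := fun v => (imbalance c a v).toNat
    by_cases hlt : departures a D (a j) < Φ (a j)
    · have hmin : ∑ v, min (departures a (insert j D) v) (Φ v) =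
          ∑ v, min (departures a D v) (Φ v) + 1 := by
        have : (1 : ℕ) = ∑ v, if v = a j then 1 else 0 := by simp
        rw [this, ← Finset.sum_add_distrib]
        refine Finset.sum_congr rfl fun v _ => ?_
        rw [departures_insert a hj]
        split_ifs with hv
        · subst hv
          lia
        · rfl
      have hsub : ∑ v, (departures a (insert j D) v - Φ v) =
          ∑ v, (departures a D v - Φ v) := by
        refine Finset.sum_congr rfl fun v _ => ?_
        rw [departures_insert a hj]
        split_ifs with hv
        · subst hv
          lia
        · rfl
      rw [hmin, hsub]
      refine le_trans ?_ ih
      have hone : (1 : ℝ≥0∞) = ∑ b, migrationOf P a D b * 1 := by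
        simp only [mul_one, sum_coe_eq_one]
      push_cast
      rw [add_comm _ (1 : ℝ≥0∞), ← add_assoc, hone, ← Finset.sum_add_distrib]
      gcongr with b
      rw [← mul_add]
      obtain hb | hb := eq_or_ne (migrationOf P a D b) 0
      · simp [hb]
      gcongr
      rw [add_comm]
      -- `a j` has lost fewer users than its initial excess and arrivals only add load, so it is
      -- overloaded in every possible `b`.
      refine one_add_sum_stabilizationCost_le P _ ?_
      have := load_le_load_add_departures
        (fun i hi => eq_of_migrationOf_ne_zero hb hi) (a j)
      simp only [Φ, imbalance] at hlt ⊢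
      lia
    · have hmin : ∑ v, min (departures a (insert j D) v) (Φ v) =
          ∑ v, min (departures a D v) (Φ v) := by
        refine Finset.sum_congr rfl fun v _ => ?_
        rw [departures_insert a hj]
        split_ifs with hv
        · subst hv
          lia
        · rfl
      have hsub : ∑ v, (departures a (insert j D) v - Φ v) =
          ∑ v, (departures a D v - Φ v) + 1 := by
        have : (1 : ℕ) = ∑ v, if v = a j then 1 else 0 := by simp
        rw [this, ← Finset.sum_add_distrib]
        refine Finset.sum_congr rfl fun v _ => ?_
        rw [departures_insert a hj]
        split_ifs with hv
        · subst hv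
          lia
        · rfl
      rw [hmin, hsub]
      calc _ ≤ ∑ b, migrationOf P a D b * (H + stabilizationCost P (imbalance c b)) +
            ((∑ v, min (departures a D v) (Φ v) : ℕ) : ℝ≥0∞) := by
            gcongr with b
            exact sum_stabilizationCost_moveUnit_le P hH _ _
        _ = H + (∑ b, migrationOf P a D b * stabilizationCost P (imbalance c b) +
            ((∑ v, min (departures a D v) (Φ v) : ℕ) : ℝ≥0∞)) := by
            simp only [mul_add, Finset.sum_add_distrib, ← Finset.sum_mul, sum_coe_eq_one, one_mul,
              add_assoc]
        _ ≤ H + (stabilizationCost P (imbalance c a) +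
            H * (∑ v, (departures a D v - Φ v) : ℕ)) := by
            gcongr
        _ = _ := by
            push_cast
            ring

theorem sum_mixture_stabilizationCost_add_le (P : V → PMF V) {H : ℝ≥0∞}
    (hH : ∀ u w, expectedHittingTime P u {w} ≤ H) (c : V → ℕ) (a : Fin m → V)
    {p : Fin m → ℝ≥0∞} (hp : ∀ i, p i ≤ 1)
    (hpow : ∀ v, ∏ i with a i = v, (1 + p i) ≤ 2 ^ (imbalance c a v).toNat) :
    ∑ b : Fin m → V, (∏ i, (p i * P (a i) (b i) + (1 - p i) * PMF.pure (a i) (b i))) *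
        stabilizationCost P (imbalance c b) + ∑ i, p i ≤
      stabilizationCost P (imbalance c a) + (H + 1) * Fintype.card V := by
  set Φ : V → ℕ := fun v => (imbalance c a v).toNat
  have hmix (b : Fin m → V) :
      -- Expanding the product separates the decisions to migrate from the choice of destinations.
      ∏ i, (p i * P (a i) (b i) + (1 - p i) * PMF.pure (a i) (b i)) =
        ∑ D, decisionWeight p D * migrationOf P a D b := by
    rw [Fintype.prod_add]
    refine Finset.sum_congr rfl fun D _ => ?_
    have hD : migrationOf P a D b =
        (∏ i ∈ D, P (a i) (b i)) * ∏ i ∈ Dᶜ, PMF.pure (a i) (b i) := by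
      rw [migrationOf, independentPMF_apply, ← Finset.prod_mul_prod_compl D]
      congr 1
      · exact Finset.prod_congr rfl fun i hi => by rw [if_pos hi]
      · exact Finset.prod_congr rfl fun i hi => by rw [if_neg (Finset.mem_compl.1 hi)]
    rw [hD, Finset.prod_mul_distrib, Finset.prod_mul_distrib, decisionWeight]
    ring
  have hsplit (D : Finset (Fin m)) : (D.card : ℝ≥0∞) =
      (∑ v, min (departures a D v) (Φ v) : ℕ) + (∑ v, (departures a D v - Φ v) : ℕ) := by
    rw [← sum_departures a D, ← Nat.cast_add, ← Finset.sum_add_distrib]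
    congr 1
    exact Finset.sum_congr rfl fun v _ => by lia
  have hillegal : ∑ D, decisionWeight p D * ((∑ v, (departures a D v - Φ v) : ℕ) : ℝ≥0∞) ≤
      Fintype.card V := by
    simp only [Nat.cast_sum, Finset.mul_sum]
    rw [Finset.sum_comm]
    calc _ ≤ ∑ v : V, (1 : ℝ≥0∞) :=
          Finset.sum_le_sum fun v _ => sum_decisionWeight_mul_departures_sub_le hp a v _ (hpow v)
      _ = _ := by simp
  calc _ = ∑ D, decisionWeight p D *
        (∑ b, migrationOf P a D b * stabilizationCost P (imbalance c b) +
          (∑ v, min (departures a D v) (Φ v) : ℕ) + (∑ v, (departures a D v - Φ v) : ℕ)) := by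
        simp only [hmix, ← sum_decisionWeight_mul_card hp, hsplit, mul_add, Finset.sum_add_distrib,
          add_assoc]
        congr 1
        simp only [Finset.sum_mul, Finset.mul_sum]
        rw [Finset.sum_comm]
        exact Finset.sum_congr rfl fun D _ => Finset.sum_congr rfl fun b _ => mul_assoc _ _ _
    _ ≤ ∑ D, decisionWeight p D *
        (stabilizationCost P (imbalance c a) + H * (∑ v, (departures a D v - Φ v) : ℕ) +
          (∑ v, (departures a D v - Φ v) : ℕ)) := by
        exact Finset.sum_le_sum fun D _ => mul_le_mul' le_rfl
          (add_le_add (sum_migrationOf_stabilizationCost_le P hH c a D) le_rfl)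
    _ = stabilizationCost P (imbalance c a) +
        (H + 1) * ∑ D, decisionWeight p D * ((∑ v, (departures a D v - Φ v) : ℕ) : ℝ≥0∞) := by
        simp only [mul_add, Finset.sum_add_distrib, ← Finset.sum_mul, sum_decisionWeight hp,
          one_mul, add_mul, add_assoc, Finset.mul_sum (a := H), mul_left_comm H]
    _ ≤ _ := by gcongr

end Round

/-! ### Multiplicative drift -/

/-- Concavity of the logarithm turns the multiplicative decrease of `u` into an additive decrease of
`1 + log u` by `δ`, so this function divided by `δ` is a supersolution. -/
theorem expectedHittingTime_le_of_multiplicativeDrift {S : Type*} [Fintype S] (K : S → PMF S)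
    (A : Set S) (u : S → ℝ) (hu : ∀ s, 0 ≤ u s) (hA : ∀ s ∉ A, 1 ≤ u s) {δ : ℝ} (hδ : 0 < δ)
    (hdrift : ∀ s ∉ A, ∑ s', (K s s').toReal * u s' + δ * u s ≤ u s) {s : S} (hs : s ∉ A) :
    expectedHittingTime K s A ≤ ENNReal.ofReal ((1 + Real.log (u s)) / δ) := by
  -- Inside `A` the value of `u` may fall below 1, even to 0; the cutoff keeps `ψ` nonnegative and
  -- below the tangent line to `1 + log` at `u s`.
  set ψ : S → ℝ := fun s => if 1 ≤ u s then 1 + Real.log (u s) else 0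
  have hψ_nonneg (s : S) : 0 ≤ ψ s := by
    simp only [ψ]
    split_ifs with h
    · linarith [Real.log_nonneg h]
    · exact le_rfl
  have hψ_of_notMem {s : S} (hs : s ∉ A) : ψ s = 1 + Real.log (u s) := if_pos (hA s hs)
  have htangent {s : S} (hs : s ∉ A) (s' : S) : ψ s' ≤ Real.log (u s) + u s' / u s := by
    have hpos : 0 < u s := one_pos.trans_le (hA s hs)
    simp only [ψ]
    split_ifs with h
    · have h1 := Real.log_le_sub_one_of_pos (div_pos (one_pos.trans_le h) hpos)
      rw [Real.log_div (by linarith) hpos.ne'] at h1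
      linarith
    · exact add_nonneg (Real.log_nonneg (hA s hs)) (div_nonneg (hu s') hpos.le)
  have hsum (s : S) : ∑ s', (K s s').toReal = 1 := by
    rw [← ENNReal.toReal_sum fun s' _ => (K s).apply_ne_top s', sum_coe_eq_one, ENNReal.toReal_one]
  have hψ_drift {s : S} (hs : s ∉ A) : ∑ s', (K s s').toReal * ψ s' + δ ≤ ψ s := by
    have hpos : 0 < u s := one_pos.trans_le (hA s hs)
    calc ∑ s', (K s s').toReal * ψ s' + δ
        ≤ ∑ s', (K s s').toReal * (Real.log (u s) + u s' / u s) + δ := by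
          gcongr with s'
          exact htangent hs s'
      _ = Real.log (u s) + (∑ s', (K s s').toReal * u s' + δ * u s) / u s := by
          simp only [mul_add, Finset.sum_add_distrib, ← Finset.sum_mul, hsum, one_mul, ← mul_div_assoc,
            ← Finset.sum_div]
          field_simp
          ring
      _ ≤ Real.log (u s) + u s / u s := by
          gcongr
          exact hdrift s hs
      _ = ψ s := by rw [hψ_of_notMem hs, div_self hpos.ne', add_comm]
  rw [← hψ_of_notMem hs]
  refine expectedHittingTime_le_of_supersolution K A (fun s => ENNReal.ofReal (ψ s / δ))
    (fun s hs => ?_) s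
  have hterm (s' : S) : K s s' * ENNReal.ofReal (ψ s' / δ) =
      ENNReal.ofReal ((K s s').toReal * (ψ s' / δ)) := by
    rw [ENNReal.ofReal_mul ENNReal.toReal_nonneg, ENNReal.ofReal_toReal ((K s).apply_ne_top s')]
  have hnn (s' : S) : 0 ≤ (K s s').toReal * (ψ s' / δ) :=
    mul_nonneg ENNReal.toReal_nonneg (div_nonneg (hψ_nonneg s') hδ.le)
  simp only [hterm]
  rw [← ENNReal.ofReal_sum_of_nonneg fun s' _ => hnn s', ← ENNReal.ofReal_one,
    ← ENNReal.ofReal_add zero_le_one (Finset.sum_nonneg fun s' _ => hnn s')]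
  refine ENNReal.ofReal_le_ofReal ?_
  rw [le_div_iff₀ hδ]
  calc _ = ∑ s', (K s s').toReal * ψ s' + δ := by
        simp only [← mul_div_assoc, ← Finset.sum_div]
        field_simp
        ring
    _ ≤ _ := hψ_drift hs

/-! ### The drift of the protocol -/

theorem expectedHittingTime_le_maxHittingTime {V : Type*} [Fintype V] (G : SimpleGraph V)
    [DecidableRel G.Adj] (u w : V) :
    expectedHittingTime (walkStep G) u {w} ≤ maxHittingTime G :=
  le_iSup₂ (f := fun u w => expectedHittingTime (walkStep G) u {w}) u w

section Model

variable {V : Type*} [DecidableEq V] {m : ℕ}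

theorem potentialAt_eq_toNat {T : Fin m → V → ℝ} {t : V → ℝ} (hT : ∀ i v, T i v = t v)
    (a : Fin m → V) (v : V) :
    potentialAt T a v = (imbalance (fun v => ⌊t v⌋₊) a v).toNat := by
  classical
  have hlast : lastPosition T a v = min (load a v) ⌊t v⌋₊ := by
    -- With a common threshold, either all users on `v` qualify or none does. The case `k = 0` is
    -- separate because `t v` may be negative.
    have hiff (k : ℕ) (hk : k ≤ load a v) :
        k ≤ (Finset.univ.filter fun i => a i = v ∧ (k : ℝ) ≤ T i v).card ↔ k ≤ ⌊t v⌋₊ := by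
      simp only [hT]
      obtain rfl | hk0 := eq_or_ne k 0
      · simp
      rw [Nat.le_floor_iff' hk0]
      by_cases h : (k : ℝ) ≤ t v
      · simpa [h, load] using hk
      · simpa [h] using hk0
    unfold lastPosition
    refine le_antisymm (le_min (Nat.findGreatest_le _) ?_) ?_
    · by_contra! hlt
      have h := Nat.findGreatest_of_ne_zero rfl (by lia : Nat.findGreatest
        (fun k => k ≤ (Finset.univ.filter fun i => a i = v ∧ (k : ℝ) ≤ T i v).card) (load a v) ≠ 0)
      rw [hiff _ (Nat.findGreatest_le _)] at h
      lia
    · refine Nat.le_findGreatest (min_le_left _ _) ?_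
      rw [hiff _ (min_le_left _ _)]
      exact min_le_right _ _
  rw [potentialAt, hlast, imbalance]
  lia

theorem load_mul_migrationProb (α : ℝ≥0) (T : Fin m → V → ℝ) (a : Fin m → V) (v : V) :
    load a v * migrationProb α T a v = α * potentialAt T a v := by
  unfold migrationProb
  obtain h0 | h0 := eq_or_ne (load a v) 0
  · have : potentialAt T a v = 0 := by simp [potentialAt, h0]
    simp [h0, this]
  · have : (load a v : ℝ≥0) ≠ 0 := by exact_mod_cast h0
    field_simp

theorem prod_one_add_migrationProb_le {α : ℝ≥0} (hα : (α : ℝ) ≤ Real.log 2)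
    (T : Fin m → V → ℝ) (a : Fin m → V) (v : V) :
    ∏ i with a i = v, (1 + (migrationProb α T a (a i) : ℝ≥0∞)) ≤ 2 ^ potentialAt T a v := by
  rw [Finset.prod_congr rfl (g := fun _ => 1 + (migrationProb α T a v : ℝ≥0∞)),
    Finset.prod_const]
  swap
  · intro i hi
    rw [(Finset.mem_filter.1 hi).2]
  change _ ^ load a v ≤ _
  suffices h : (1 + (migrationProb α T a v : ℝ)) ^ load a v ≤ 2 ^ potentialAt T a v by
    exact_mod_cast h
  have hmul : (load a v : ℝ) * migrationProb α T a v = α * potentialAt T a v := by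
    exact_mod_cast load_mul_migrationProb α T a v
  calc (1 + (migrationProb α T a v : ℝ)) ^ load a v
      ≤ Real.exp (migrationProb α T a v) ^ load a v := by
        gcongr
        linarith [Real.add_one_le_exp (migrationProb α T a v : ℝ)]
    _ = Real.exp α ^ potentialAt T a v := by
        rw [← Real.exp_nat_mul, hmul, mul_comm, Real.exp_nat_mul]
    _ ≤ 2 ^ potentialAt T a v := by
        gcongr
        exact (Real.le_log_iff_exp_le two_pos).1 hα

variable [Fintype V]

/-- A balanced state respects all capacities, so their sum is at least the number of users. -/
theorem sum_imbalance_nonpos {T : Fin m → V → ℝ} {t : V → ℝ} (hT : ∀ i v, T i v = t v)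
    (hF : Feasible T) (a : Fin m → V) : ∑ v, imbalance (fun v => ⌊t v⌋₊) a v ≤ 0 := by
  obtain ⟨b, hb⟩ := hF
  have hle (v : V) : load b v ≤ ⌊t v⌋₊ := by
    obtain h0 | h0 := Nat.eq_zero_or_pos (load b v)
    · simp [h0]
    obtain ⟨i, hi⟩ := Finset.card_pos.1 h0
    obtain rfl : b i = v := (Finset.mem_filter.1 hi).2
    exact Nat.le_floor ((hb i).trans_eq (hT i _))
  have h := Finset.sum_le_sum fun v (_ : v ∈ Finset.univ) => hle v
  rw [sum_load, ← sum_load a] at h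
  simp only [imbalance, Finset.sum_sub_distrib]
  exact sub_nonpos.2 (by exact_mod_cast h)

theorem potential_le (T : Fin m → V → ℝ) (a : Fin m → V) : potential T a ≤ m :=
  (Finset.sum_le_sum fun _ _ => Nat.sub_le _ _).trans_eq (sum_load a)

theorem sum_migrationProb (α : ℝ≥0) (T : Fin m → V → ℝ) (a : Fin m → V) :
    ∑ i, migrationProb α T a (a i) = α * potential T a := by
  rw [← Finset.sum_fiberwise_of_maps_to (t := Finset.univ) (g := a) fun i _ => Finset.mem_univ _,
    potential, Nat.cast_sum, Finset.mul_sum]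
  refine Finset.sum_congr rfl fun v _ => ?_
  rw [← load_mul_migrationProb, Finset.sum_congr rfl (g := fun _ => migrationProb α T a v)]
  · rw [Finset.sum_const, nsmul_eq_mul, load]
  · intro i hi
    rw [(Finset.mem_filter.1 hi).2]

variable (G : SimpleGraph V) [DecidableRel G.Adj]

theorem sum_userRound_stabilizationCost_add_le {α : ℝ≥0} (hα₁ : α ≤ 1)
    (hα : (α : ℝ) ≤ Real.log 2) {T : Fin m → V → ℝ} {t : V → ℝ} (hT : ∀ i v, T i v = t v)
    (a : Fin m → V) :
    ∑ b, userRound G α hα₁ T a b *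
        stabilizationCost (walkStep G) (imbalance (fun v => ⌊t v⌋₊) b) + α * potential T a ≤
      stabilizationCost (walkStep G) (imbalance (fun v => ⌊t v⌋₊) a) +
        (maxHittingTime G + 1) * Fintype.card V := by
  have h := sum_mixture_stabilizationCost_add_le (walkStep G)
    (expectedHittingTime_le_maxHittingTime G) (fun v => ⌊t v⌋₊) a
    (p := fun i => (migrationProb α T a (a i) : ℝ≥0∞))
    (fun i => by exact_mod_cast migrationProb_le_one hα₁ T a (a i))
    (fun v => by
      rw [← potentialAt_eq_toNat hT]
      exact prod_one_add_migrationProb_le hα T a v)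
  have hsum : ∑ i, (migrationProb α T a (a i) : ℝ≥0∞) = α * potential T a := by
    exact_mod_cast sum_migrationProb α T a
  rw [hsum] at h
  exact h

end Model

theorem one_sixth_le_alpha : 1 / 6 ≤ (alpha : ℝ) := by
  change 1 / 6 ≤ 1 / (2 * Real.exp 1)
  exact one_div_le_one_div_of_le (by positivity) (by linarith [Real.exp_one_lt_d9])

theorem alpha_le_log_two : (alpha : ℝ) ≤ Real.log 2 := by
  have h : (1 : ℝ) / (2 * Real.exp 1) ≤ 1 / 4 :=
    one_div_le_one_div_of_le (by positivity) (by linarith [Real.exp_one_gt_d9])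
  exact h.trans (by linarith [Real.log_two_gt_d9])

theorem one_le_maxHittingTime {V : Type*} [Fintype V] (G : SimpleGraph V) [DecidableRel G.Adj]
    {u w : V} (huw : u ≠ w) : 1 ≤ maxHittingTime G := by
  refine le_trans ?_ (expectedHittingTime_le_maxHittingTime G u w)
  rw [expectedHittingTime_of_notMem _ (by simpa using huw)]
  exact le_self_add

/-! ### Assembling the drift estimates -/

section Main

variable {V : Type*} [Fintype V] [DecidableEq V] {m : ℕ}

theorem exists_imbalance_pos {T : Fin m → V → ℝ} {t : V → ℝ} (hT : ∀ i v, T i v = t v)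
    {a : Fin m → V} (ha : potential T a ≠ 0) :
    ∃ v, 0 < imbalance (fun v => ⌊t v⌋₊) a v := by
  by_contra! h
  refine ha (Finset.sum_eq_zero fun v _ => ?_)
  rw [potentialAt_eq_toNat hT, Int.toNat_of_nonpos (h v)]

variable (G : SimpleGraph V) [DecidableRel G.Adj]

theorem expectedHittingTime_userRound_le {T : Fin m → V → ℝ} (hI : UserIndependent T)
    (hF : Feasible T) (a₀ : Fin m → V) :
    expectedHittingTime (userRound G alpha alpha_le_one T) a₀
        {a | (potential T a : ℝ≥0∞) ≤ 36 * (Fintype.card V : ℝ≥0∞) * maxHittingTime G} ≤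
      36 * maxHittingTime G * ENNReal.ofReal (Real.log m) := by
  obtain ⟨t, hT⟩ := hI
  set A := {a : Fin m → V |
    (potential T a : ℝ≥0∞) ≤ 36 * (Fintype.card V : ℝ≥0∞) * maxHittingTime G}
  by_cases ha₀ : a₀ ∈ A
  · rw [expectedHittingTime_of_mem _ ha₀]
    exact zero_le
  have hpos {a : Fin m → V} (ha : a ∉ A) : potential T a ≠ 0 := by
    intro h0
    simp [A, h0] at ha
  obtain ⟨v, hv⟩ := exists_imbalance_pos hT (hpos ha₀)
  obtain ⟨w, hw⟩ : ∃ w, imbalance (fun v => ⌊t v⌋₊) a₀ w < 0 := by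
    by_contra! h
    exact ((Finset.sum_pos' (fun w _ => h w) ⟨v, Finset.mem_univ v, hv⟩).trans_le
      (sum_imbalance_nonpos hT hF a₀)).false
  have hH1 : 1 ≤ maxHittingTime G := one_le_maxHittingTime G (u := v) (w := w)
    (by rintro rfl; lia)
  have hcard : 1 ≤ Fintype.card V := Fintype.card_pos_iff.2 ⟨v⟩
  have hcard' : (1 : ℝ) ≤ Fintype.card V := by exact_mod_cast hcard
  -- An infinite hitting time would make every state a target.
  have hfin : maxHittingTime G ≠ ∞ := by
    intro htop
    refine ha₀ ?_
    have : (Fintype.card V : ℝ≥0∞) ≠ 0 := by exact_mod_cast (by lia : Fintype.card V ≠ 0)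
    simp [A, htop, ENNReal.mul_top, this]
  obtain ⟨H, hH⟩ : ∃ H : ℝ≥0, maxHittingTime G = H := ⟨_, (ENNReal.coe_toNNReal hfin).symm⟩
  have hH1' : (1 : ℝ) ≤ H := by
    rw [hH] at hH1
    exact_mod_cast hH1
  set U : (Fin m → V) → ℝ≥0∞ := fun a =>
    stabilizationCost (walkStep G) (imbalance (fun v => ⌊t v⌋₊) a)
  have hU (a : Fin m → V) : U a ≤ H * potential T a := by
    have h := stabilizationCost_le (walkStep G) (expectedHittingTime_le_maxHittingTime G)
      (imbalance (fun v => ⌊t v⌋₊) a) (sum_imbalance_nonpos hT hF a)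
    simp only [← potentialAt_eq_toNat hT] at h
    rw [hH] at h
    exact h
  have hUtop (a : Fin m → V) : U a ≠ ∞ :=
    ne_top_of_le_ne_top (ENNReal.mul_ne_top ENNReal.coe_ne_top (ENNReal.natCast_ne_top _)) (hU a)
  have hUreal (a : Fin m → V) : (U a).toReal ≤ H * potential T a := by
    have h := ENNReal.toReal_mono
      (ENNReal.mul_ne_top ENNReal.coe_ne_top (ENNReal.natCast_ne_top _)) (hU a)
    simpa using h
  have hlarge {a : Fin m → V} (ha : a ∉ A) :
      36 * (Fintype.card V : ℝ) * H < potential T a := by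
    have h : 36 * (Fintype.card V : ℝ≥0∞) * maxHittingTime G < potential T a := not_le.1 ha
    rw [hH] at h
    exact_mod_cast h
  have hdrift (a : Fin m → V) (ha : a ∉ A) :
      ∑ b, (userRound G alpha alpha_le_one T a b).toReal * (U b).toReal +
        1 / (12 * H) * (U a).toReal ≤ (U a).toReal := by
    have h := sum_userRound_stabilizationCost_add_le G alpha_le_one alpha_le_log_two hT a
    rw [hH] at h
    have hterm (b : Fin m → V) : userRound G alpha alpha_le_one T a b * U b ≠ ∞ :=
      ENNReal.mul_ne_top (PMF.apply_ne_top _ _) (hUtop b)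
    have h' := ENNReal.toReal_mono (ENNReal.add_ne_top.2 ⟨hUtop a, ENNReal.mul_ne_top
      (by simp) (ENNReal.natCast_ne_top _)⟩) h
    rw [ENNReal.toReal_add (ENNReal.sum_ne_top.2 fun b _ => hterm b)
        (ENNReal.mul_ne_top ENNReal.coe_ne_top (ENNReal.natCast_ne_top _)),
      ENNReal.toReal_sum fun b _ => hterm b,
      ENNReal.toReal_add (hUtop a) (ENNReal.mul_ne_top (by simp) (ENNReal.natCast_ne_top _)),
      ENNReal.toReal_mul, ENNReal.toReal_mul, ENNReal.toReal_add (by simp) (by simp)] at h'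
    simp only [ENNReal.toReal_mul, ENNReal.coe_toReal, ENNReal.toReal_natCast,
      ENNReal.toReal_one] at h'
    have hα : 1 / 6 * (potential T a : ℝ) ≤ alpha * potential T a := by
      gcongr
      exact one_sixth_le_alpha
    -- Here `(H + 1)n ≤ 2Hn < Φ/18`. Of the gain `Φ/6`, at least `Φ/12` thus survives, and this is
    -- at least `U/(12H)`.
    have hn : ((H : ℝ) + 1) * Fintype.card V ≤ 1 / 12 * potential T a := by
      have := mul_le_mul_of_nonneg_right hH1' (Nat.cast_nonneg (α := ℝ) (Fintype.card V))
      have := hlarge ha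
      nlinarith
    have hδ : 1 / (12 * H) * (U a).toReal ≤ 1 / 12 * potential T a := by
      calc 1 / (12 * (H : ℝ)) * (U a).toReal
          ≤ 1 / (12 * (H : ℝ)) * (H * potential T a) := by
            gcongr
            exact hUreal a
        _ = 1 / 12 * potential T a := by
            field_simp
    linarith
  have hU1 (a : Fin m → V) (ha : a ∉ A) : 1 ≤ (U a).toReal := by
    obtain ⟨v, hv⟩ := exists_imbalance_pos hT (hpos ha)
    have h := ENNReal.toReal_mono (hUtop a) (one_le_stabilizationCost (walkStep G) hv)
    simpa using h
  refine (expectedHittingTime_le_of_multiplicativeDrift _ A (fun a => (U a).toReal)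
    (fun _ => ENNReal.toReal_nonneg) hU1 (by positivity) hdrift ha₀).trans ?_
  have hm : (potential T a₀ : ℝ) ≤ m := by exact_mod_cast potential_le T a₀
  -- From `36nH < Φ ≤ m`: a start outside the target forces `H ≤ m`, so `U ≤ m²`, and `m` is large
  -- enough for `log m` to absorb the additive 1.
  have hHm : 36 * (H : ℝ) ≤ m := by
    have := hlarge ha₀
    nlinarith
  have hm3 : (36 : ℝ) ≤ m := by linarith
  have hlog1 : 1 ≤ Real.log m := by
    rw [Real.le_log_iff_exp_le (by linarith)]
    linarith [Real.exp_one_lt_d9]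
  have hlogU : Real.log (U a₀).toReal ≤ 2 * Real.log m := by
    calc Real.log (U a₀).toReal ≤ Real.log (m * m) := by
          refine Real.log_le_log (one_pos.trans_le (hU1 a₀ ha₀)) ((hUreal a₀).trans ?_)
          gcongr
          linarith
      _ = 2 * Real.log m := by
          rw [Real.log_mul (by linarith) (by linarith)]
          ring
  rw [hH, ← ENNReal.ofReal_coe_nnreal, ← ENNReal.ofReal_ofNat, ← ENNReal.ofReal_mul (by norm_num),
    ← ENNReal.ofReal_mul (by positivity)]
  refine ENNReal.ofReal_le_ofReal ?_
  calc (1 + Real.log (U a₀).toReal) / (1 / (12 * (H : ℝ)))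
      = 12 * H * (1 + Real.log (U a₀).toReal) := by field_simp
    _ ≤ 12 * H * (3 * Real.log m) := by
        gcongr
        linarith
    _ = 36 * H * Real.log m := by ring

end Main

end

end ThresholdBalancing

theorem theorem5 :
    ∃ C : ℝ≥0, ∀ (V : Type*) [Fintype V] [DecidableEq V] (G : SimpleGraph V) [DecidableRel G.Adj]
      (m : ℕ) (T : Fin m → V → ℝ) (a₀ : Fin m → V),
      G.Connected →
      ThresholdBalancing.UserIndependent T →
      ThresholdBalancing.Feasible T →
      ThresholdBalancing.expectedHittingTime
          (ThresholdBalancing.userRound G ThresholdBalancing.alpha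
            ThresholdBalancing.alpha_le_one T)
          a₀
          {a | (ThresholdBalancing.potential T a : ℝ≥0∞) ≤
            C * (Fintype.card V : ℝ≥0∞) * ThresholdBalancing.maxHittingTime G}
        ≤ C * ThresholdBalancing.maxHittingTime G * ENNReal.ofReal (Real.log m) := by
  refine ⟨36, fun V _ _ G _ m T a₀ _ hI hF => ?_⟩
  exact_mod_cast ThresholdBalancing.expectedHittingTime_userRound_le G hI hF a₀
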